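/- Let $c$ and $m$ be integers with $m>1$, and let $d$ be a positive rational such that $dm\in\mathbb{N}$ and $c+dm>0$. Let $k\ge 1$ and let $a_1,\dots,a_k$ be positive integers. Let $P_i/Q_i=[0;a_1,\dots,a_i]$ be the convergents, with canonical numerators and denominators: $P_{-1}=1$, $P_0=0$, $Q_{-1}=0$, $Q_0=1$, $P_i=a_iP_{i-1}+P_{i-2}$ and $Q_i=a_iQ_{i-1}+Q_{i-2}$ for $1\le i\le k$. Put $C=Q_{k-1}+P_k+cQ_k$. For $q,z\in\mathbb{C}$ write $(z;q)_0=1$ and $(z;q)_n=\prod_{i=0}^{n-1}(1-zq^i)$ for $n\ge1$, and let $\sqrt{\cdot}$ be the principal square root (which is not real for a negative argument, so that $a,b$ below may be non-real when $k$ is odd). If $k$ is even, set $\varepsilon=1$, $a=\frac{C-\sqrt{C^2+4}}{2}$ and $b=\frac{C+\sqrt{C^2+4}}{2}$. If $k$ is odd, set $\varepsilon=-1$, $a=\frac{C-\sqrt{C^2-4}}{2}$ and $b=\frac{C+\sqrt{C^2-4}}{2}$. Then the infinite continued fraction whose partial quotients are $a_1,\dots,a_k,c+dm,a_1,\dots,a_k,c+dm^2,a_1,\dots,a_k,c+dm^3,\dots$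 converges, and $$[0;\overline{a_1,\dots,a_k,c+dm^n}]_{n=1}^{\infty}=\frac{P_k}{Q_k}+\frac{\varepsilon}{Q_k(mdQ_k+a)}\cdot\frac{\displaystyle\sum_{n=0}^{\infty}\frac{(b/(dQ_k))^n\,m^{-n(n+3)/2}}{(1/m;1/m)_n\,(-a/(dQ_km^2);1/m)_n}}{\displaystyle\sum_{n=0}^{\infty}\frac{(b/(dQ_k))^n\,m^{-n(n+1)/2}}{(1/m;1/m)_n\,(-a/(dQ_km);1/m)_n}},$$ where $mdQ_k+a\neq0$, none of the $q$-products in the denominators vanishes, both series converge, and the series in the denominator has a nonzero sum. -/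

import Mathlib

open Filter Topology

noncomputable section

/-- The (finite or infinite) continued fraction `[0; b₁, b₂, …]` with partial quotients `s`. -/
def zeroHeadCF (s : Stream'.Seq ℝ) : GenContFract ℝ :=
  ⟨0, s.map fun b => ⟨1, b⟩⟩

/-- The finite continued fraction `[0; a₁, …, a_k]`; here `a i` is `a_{i+1}`. -/
def finiteCF {k : ℕ} (a : Fin k → ℕ) : GenContFract ℝ :=
  zeroHeadCF (Stream'.Seq.ofList (List.ofFn fun i => (a i : ℝ)))

/-- The partial quotients `a₁, …, a_k, u 1, a₁, …, a_k, u 2, a₁, …, a_k, u 3, …`. -/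
def interlacedQuotients {k : ℕ} (a : Fin k → ℕ) (u : ℕ → ℝ) (j : ℕ) : ℝ :=
  if h : j % (k + 1) < k then (a ⟨j % (k + 1), h⟩ : ℝ) else u (j / (k + 1) + 1)

/-- The infinite continued fraction `[0; overline(a₁, …, a_k, u n)]_{n = 1}^∞`. -/
def interlacedCF {k : ℕ} (a : Fin k → ℕ) (u : ℕ → ℝ) : GenContFract ℝ :=
  zeroHeadCF (Stream'.Seq.ofStream (interlacedQuotients a u))

/-- The canonical numerator `P_i` of `[0; a₁, …, a_i]`, for `0 ≤ i ≤ k`. -/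
def convNum {k : ℕ} (a : Fin k → ℕ) (i : ℕ) : ℝ := (finiteCF a).nums i

/-- The canonical denominator `Q_i` of `[0; a₁, …, a_i]`, for `0 ≤ i ≤ k`. -/
def convDen {k : ℕ} (a : Fin k → ℕ) (i : ℕ) : ℝ := (finiteCF a).dens i

/-- The `q`-product `(z; q)_n = ∏_{0 ≤ i < n} (1 - z q ^ i)`. -/
def qProd (z q : ℂ) (n : ℕ) : ℂ := ∏ i ∈ Finset.range n, (1 - z * q ^ i)

/-- The `n`-th term of the series in the numerator (with `D = d Q_k`). -/
def upperTerm (m D α β : ℂ) (n : ℕ) : ℂ :=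
  (β / D) ^ n * (m ^ (n * (n + 3) / 2))⁻¹ /
    (qProd (1 / m) (1 / m) n * qProd (-α / (D * m ^ 2)) (1 / m) n)

/-- The `n`-th term of the series in the denominator (with `D = d Q_k`). -/
def lowerTerm (m D α β : ℂ) (n : ℕ) : ℂ :=
  (β / D) ^ n * (m ^ (n * (n + 1) / 2))⁻¹ /
    (qProd (1 / m) (1 / m) n * qProd (-α / (D * m)) (1 / m) n)

/-- Nothing in the closed form degenerates: `m D + α` and all the `q`-products are nonzero, both
series converge and the series in the denominator has a nonzero sum. -/
def ClosedFormWellDefined (m D α β : ℂ) : Prop :=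
  m * D + α ≠ 0 ∧
  (∀ n, qProd (1 / m) (1 / m) n ≠ 0) ∧
  (∀ n, qProd (-α / (D * m ^ 2)) (1 / m) n ≠ 0) ∧
  (∀ n, qProd (-α / (D * m)) (1 / m) n ≠ 0) ∧
  Summable (upperTerm m D α β) ∧
  Summable (lowerTerm m D α β) ∧
  ∑' n, lowerTerm m D α β n ≠ 0

end

noncomputable section

/-! The argument is of Pincherle type: a null solution of a three-term recurrence yields the limit
of the continued fraction. With `q = 1/m`, the sums `S_j = shiftSum q (α/D) (β/D) j` satisfy a
three-term recurrence (`shiftSum_recurrence`), and `S_0`, `S_1` are the lower and upper series.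
Dividing `S_j` by `∏_{i<j} (m^(i+1) D + α)` gives `w_j = (α + β + D m^(j+1)) w_(j+1) - αβ w_(j+2)`.
Since `α + β = C` and `αβ = -(-1)^k`, this is the recurrence of the continued fraction contracted to
one step per block of `k + 1` quotients.

As `S_j → 1` and the products blow up, `w` is a nonzero null solution. Spread back over the blocks,
it gives a null combination of canonical numerators and denominators; denominators being at least 1,
the convergents converge (`tendsto_convs_interlacedCF`). The same argument shows `w_0 ≠ 0`, that is,
the lower series has a nonzero sum. -/

/-! ### The shifted `q`-series: bounds, limit and recurrence. -/

theorem qProd_zero (z q : ℂ) : qProd z q 0 = 1 := by simp [qProd]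

theorem qProd_succ (z q : ℂ) (n : ℕ) : qProd z q (n + 1) = qProd z q n * (1 - z * q ^ n) :=
  Finset.prod_range_succ _ _

theorem qProd_succ' (z q : ℂ) (n : ℕ) : qProd z q (n + 1) = (1 - z) * qProd (z * q) q n := by
  unfold qProd
  rw [Finset.prod_range_succ', mul_comm]
  congr 1
  · simp
  · exact Finset.prod_congr rfl fun i _ => by ring

/-- A nowhere vanishing sequence with a nonzero limit is bounded away from zero. -/
theorem exists_pos_le_norm_of_tendsto_one {f : ℕ → ℂ} (hf : Tendsto f atTop (𝓝 1))
    (h0 : ∀ n, f n ≠ 0) : ∃ δ > 0, ∀ n, δ ≤ ‖f n‖ := by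
  have hi : Tendsto (fun n => ‖(f n)⁻¹‖) atTop (𝓝 ‖(1 : ℂ)⁻¹‖) := (hf.inv₀ one_ne_zero).norm
  obtain ⟨K, hK⟩ := hi.bddAbove_range
  refine ⟨(max K 1)⁻¹, by positivity, fun n => ?_⟩
  have h1 : ‖(f n)⁻¹‖ ≤ max K 1 := (hK ⟨n, rfl⟩).trans (le_max_left _ _)
  rw [norm_inv] at h1
  exact inv_le_of_inv_le₀ (norm_pos_iff.2 (h0 n)) h1

theorem pow_le_norm_qProd {z q : ℂ} {δ : ℝ} (hδ : 0 < δ) (h : ∀ i, δ ≤ ‖1 - z * q ^ i‖) (n : ℕ) :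
    δ ^ n ≤ ‖qProd z q n‖ := by
  unfold qProd
  rw [norm_prod]
  calc δ ^ n = ∏ _i ∈ Finset.range n, δ := by simp
    _ ≤ _ := Finset.prod_le_prod (fun _ _ => hδ.le) fun i _ => h i

theorem triangle_succ (n : ℕ) : (n + 1) * (n + 1 + 1) / 2 = n * (n + 1) / 2 + (n + 1) := by
  have : (n + 1) * (n + 1 + 1) = n * (n + 1) + (n + 1) * 2 := by ring
  rw [this, Nat.add_mul_div_right _ _ (by norm_num)]

/-- `q`-series with entries `(b q^j)^n q^(n(n+1)/2) / ((q; q)_n (-a q^(j+1); q)_n)`. -/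
def shiftTerm (q a b : ℂ) (j n : ℕ) : ℂ :=
  (b * q ^ j) ^ n * q ^ (n * (n + 1) / 2) / (qProd q q n * qProd (-(a * q ^ (j + 1))) q n)

def shiftSum (q a b : ℂ) (j : ℕ) : ℂ := ∑' n, shiftTerm q a b j n

theorem summable_pow_mul_pow_triangle {K r : ℝ} (hK : 0 < K) (hr : 0 < r) (hr1 : r < 1) :
    Summable fun n : ℕ => K ^ n * r ^ (n * (n + 1) / 2) := by
  refine summable_of_ratio_test_tendsto_lt_one (l := 0) one_pos
    (Eventually.of_forall fun n => by positivity) ?_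
  have h : ∀ n : ℕ, ‖K ^ (n + 1) * r ^ ((n + 1) * (n + 1 + 1) / 2)‖ /
      ‖K ^ n * r ^ (n * (n + 1) / 2)‖ = K * r * r ^ n := fun n => by
    rw [Real.norm_of_nonneg (by positivity), Real.norm_of_nonneg (by positivity), triangle_succ]
    field_simp
    ring
  simp_rw [h]
  simpa using (tendsto_pow_atTop_nhds_zero_of_lt_one hr.le hr1).const_mul (K * r)

section

variable {q a b : ℂ}

theorem one_sub_mul_pow_ne_zero (hq : ‖q‖ < 1) (n : ℕ) : 1 - q * q ^ n ≠ 0 := by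
  intro h
  have h1 : q ^ (n + 1) = 1 := by rw [pow_succ']; exact (sub_eq_zero.1 h).symm
  have h2 : ‖q‖ ^ (n + 1) < 1 := pow_lt_one₀ (norm_nonneg _) hq (by omega)
  rw [← norm_pow, h1] at h2
  simp at h2

theorem qProd_self_ne_zero (hq : ‖q‖ < 1) (n : ℕ) : qProd q q n ≠ 0 :=
  Finset.prod_ne_zero_iff.2 fun i _ => one_sub_mul_pow_ne_zero hq i

theorem qProd_shift_ne_zero (ha : ∀ i, 1 + a * q ^ (i + 1) ≠ 0) (j n : ℕ) :
    qProd (-(a * q ^ (j + 1))) q n ≠ 0 :=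
  Finset.prod_ne_zero_iff.2 fun i _ => by
    have := ha (j + i)
    convert this using 1
    ring

/-- The factors of the second product for shift `j` form a tail of one sequence tending to 1, so a
single lower bound `η`, hence a single `K`, serves all `j`. -/
theorem exists_bound_shiftTerm (hq : ‖q‖ < 1) (hb : b ≠ 0)
    (ha : ∀ i, 1 + a * q ^ (i + 1) ≠ 0) :
    ∃ K > 0, ∀ j n, ‖shiftTerm q a b j n‖ ≤
      (‖q‖ ^ j) ^ n * (K ^ n * ‖q‖ ^ (n * (n + 1) / 2)) := by
  have hpow : Tendsto (fun n => q ^ n) atTop (𝓝 0) := tendsto_pow_atTop_nhds_zero_of_norm_lt_one hq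
  obtain ⟨δ, hδ, h1⟩ := exists_pos_le_norm_of_tendsto_one (f := fun n => 1 - q * q ^ n)
    (by simpa using (hpow.const_mul q).const_sub 1) (one_sub_mul_pow_ne_zero hq)
  obtain ⟨η, hη, h2⟩ := exists_pos_le_norm_of_tendsto_one (f := fun n => 1 + a * q ^ (n + 1))
    (by simpa using ((hpow.comp (tendsto_add_atTop_nat 1)).const_mul a).const_add 1) ha
  have hb' : 0 < ‖b‖ := norm_pos_iff.2 hb
  refine ⟨‖b‖ / (δ * η), by positivity, fun j n => ?_⟩
  have e1 := pow_le_norm_qProd hδ h1 n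
  have e2 : η ^ n ≤ ‖qProd (-(a * q ^ (j + 1))) q n‖ := pow_le_norm_qProd hη (fun i => by
    have := h2 (j + i)
    convert this using 2
    ring) n
  unfold shiftTerm
  rw [norm_div, norm_mul, norm_mul, norm_pow, norm_pow, norm_mul, norm_pow]
  calc _ ≤ (‖b‖ * ‖q‖ ^ j) ^ n * ‖q‖ ^ (n * (n + 1) / 2) / (δ ^ n * η ^ n) := by gcongr
    _ = _ := by rw [div_pow, mul_pow, mul_pow]; ring

theorem summable_shiftTerm (hq0 : q ≠ 0) (hq : ‖q‖ < 1) (hb : b ≠ 0)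
    (ha : ∀ i, 1 + a * q ^ (i + 1) ≠ 0) (j : ℕ) : Summable (shiftTerm q a b j) := by
  obtain ⟨K, hK, h⟩ := exists_bound_shiftTerm hq hb ha
  have hq' := norm_pos_iff.2 hq0
  refine Summable.of_norm_bounded (summable_pow_mul_pow_triangle hK hq' hq) fun n =>
    (h j n).trans (mul_le_of_le_one_left (by positivity) ?_)
  exact pow_le_one₀ (by positivity) (pow_le_one₀ (by positivity) hq.le)

/-- Dominated convergence: the factor `(‖q‖^j)^n` kills every term except `n = 0`. -/
theorem tendsto_shiftSum (hq0 : q ≠ 0) (hq : ‖q‖ < 1) (hb : b ≠ 0)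
    (ha : ∀ i, 1 + a * q ^ (i + 1) ≠ 0) : Tendsto (shiftSum q a b) atTop (𝓝 1) := by
  obtain ⟨K, hK, h⟩ := exists_bound_shiftTerm hq hb ha
  have hq' := norm_pos_iff.2 hq0
  have key := tendsto_tsum_of_dominated_convergence (𝓕 := atTop) (f := shiftTerm q a b)
    (g := fun n : ℕ => if n = 0 then (1 : ℂ) else 0)
    (summable_pow_mul_pow_triangle hK hq' hq) (fun n => ?_)
    (Eventually.of_forall fun j n => (h j n).trans (mul_le_of_le_one_left (by positivity)
      (pow_le_one₀ (by positivity) (pow_le_one₀ (by positivity) hq.le))))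
  · rw [tsum_ite_eq] at key
    exact key
  · rcases Nat.eq_zero_or_pos n with rfl | hn
    · simp [shiftTerm, qProd_zero]
    · rw [if_neg hn.ne']
      refine squeeze_zero_norm (fun j => h j n) ?_
      have := ((tendsto_pow_atTop_nhds_zero_of_lt_one hq'.le hq).pow n).mul_const
        (K ^ n * ‖q‖ ^ (n * (n + 1) / 2))
      simpa [hn.ne'] using this

theorem shiftTerm_succ_sub (hq0 : q ≠ 0) (hq : ‖q‖ < 1)
    (ha : ∀ i, 1 + a * q ^ (i + 1) ≠ 0) (j n : ℕ) :
    (1 + a * q ^ (j + 1)) * (shiftTerm q a b j (n + 1) - shiftTerm q a b (j + 1) (n + 1)) =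
      b * q ^ (j + 1) * shiftTerm q a b (j + 1) n -
        a * b * q ^ (2 * j + 3) / (1 + a * q ^ (j + 2)) * shiftTerm q a b (j + 2) n := by
  have z1 := one_sub_mul_pow_ne_zero hq n
  have z2 : 1 + a * q ^ (j + 1) ≠ 0 := ha j
  have z3 : 1 + a * q ^ (j + 2) ≠ 0 := ha (j + 1)
  have z4 : 1 + a * q ^ (j + 2 + n) ≠ 0 := by convert ha (j + 1 + n) using 3; ring
  have z5 := qProd_self_ne_zero hq n
  have z6 := qProd_shift_ne_zero ha (j + 1) n
  have f1 : qProd (-(a * q ^ (j + 1))) q (n + 1) =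
      (1 + a * q ^ (j + 1)) * qProd (-(a * q ^ (j + 1 + 1))) q n := by
    rw [qProd_succ', show -(a * q ^ (j + 1)) * q = -(a * q ^ (j + 1 + 1)) by ring]
    ring
  have f2 : qProd (-(a * q ^ (j + 1 + 1))) q (n + 1) =
      qProd (-(a * q ^ (j + 1 + 1))) q n * (1 + a * q ^ (j + 2 + n)) := by
    rw [qProd_succ]; ring
  have f3 : qProd (-(a * q ^ (j + 2 + 1))) q n =
      qProd (-(a * q ^ (j + 1 + 1))) q n * (1 + a * q ^ (j + 2 + n)) / (1 + a * q ^ (j + 2)) := by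
    rw [eq_div_iff z3, ← f2, qProd_succ',
      show -(a * q ^ (j + 1 + 1)) * q = -(a * q ^ (j + 2 + 1)) by ring]
    ring
  unfold shiftTerm
  rw [f1, f2, f3, qProd_succ, triangle_succ]
  set R := qProd (-(a * q ^ (j + 1 + 1))) q n
  set T := qProd q q n
  have c : a * b * q ^ (2 * j + 3) = (a * q ^ (j + 1)) * (b * q ^ (j + 2)) := by ring
  rw [c]
  clear f1 f2 f3 c
  -- The factors stay opaque while denominators are cleared; `V` cancels, and only `U`, `W`, `Z`
  -- need expanding for the final polynomial identity.
  have h2 : 1 + a * q ^ (j + 1) = 1 + a * q ^ j * q := by ring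
  have h4 : 1 + a * q ^ (j + 2 + n) = 1 + a * q ^ j * q * q * q ^ n := by ring
  generalize 1 + a * q ^ (j + 1) = U at *
  generalize 1 + a * q ^ (j + 2) = V at *
  generalize 1 + a * q ^ (j + 2 + n) = W at *
  generalize hZ : 1 - q * q ^ n = Z at z1 ⊢
  simp only [pow_add, mul_pow, pow_one, pow_two]
  generalize q ^ (n * (n + 1) / 2) = t
  generalize q ^ j = x at *
  generalize q ^ n = y at *
  field_simp
  rw [h2, h4, ← hZ]
  ring

/-- The three-term recurrence of the shifted `q`-series. -/
theorem shiftSum_recurrence (hq0 : q ≠ 0) (hq : ‖q‖ < 1) (hb : b ≠ 0)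
    (ha : ∀ i, 1 + a * q ^ (i + 1) ≠ 0) (j : ℕ) :
    (1 + a * q ^ (j + 1)) * shiftSum q a b j = (1 + (a + b) * q ^ (j + 1)) * shiftSum q a b (j + 1)
      - a * b * q ^ (2 * j + 3) / (1 + a * q ^ (j + 2)) * shiftSum q a b (j + 2) := by
  have s := summable_shiftTerm hq0 hq hb ha
  have h : (1 + a * q ^ (j + 1)) * (shiftSum q a b j - shiftSum q a b (j + 1)) =
      b * q ^ (j + 1) * shiftSum q a b (j + 1) -
        a * b * q ^ (2 * j + 3) / (1 + a * q ^ (j + 2)) * shiftSum q a b (j + 2) := by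
    unfold shiftSum
    -- Both terms at `n = 0` equal 1 and cancel, so the difference starts at `n + 1`, where the
    -- termwise identity applies.
    rw [← (s j).tsum_sub (s (j + 1)), ((s j).sub (s (j + 1))).tsum_eq_zero_add, ← tsum_mul_left,
      ← tsum_mul_left, ← ((s (j + 1)).mul_left _).tsum_sub ((s (j + 2)).mul_left _)]
    simp_rw [← shiftTerm_succ_sub hq0 hq ha]
    rw [tsum_mul_left]
    simp [shiftTerm, qProd_zero]
  linear_combination h

end

/-! ### Continuants of the finite and interlaced continued fractions. -/

/-- `contsAux` is shifted by one: `contsAux 0` holds the values of index `-1`, and `contsAux (n +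
1)` those of index `n`. -/
theorem contsAux_zeroHeadCF (s : Stream'.Seq ℝ) {n : ℕ} {b : ℝ} (h : s.get? n = some b) :
    ((zeroHeadCF s).contsAux (n + 2)).a =
        b * ((zeroHeadCF s).contsAux (n + 1)).a + ((zeroHeadCF s).contsAux n).a ∧
      ((zeroHeadCF s).contsAux (n + 2)).b =
        b * ((zeroHeadCF s).contsAux (n + 1)).b + ((zeroHeadCF s).contsAux n).b := by
  have hs : (zeroHeadCF s).s.get? n = some ⟨1, b⟩ := by
    simp [zeroHeadCF, Stream'.Seq.map_get?, h]
  rw [GenContFract.contsAux_recurrence hs rfl rfl]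
  simp

section

variable {k : ℕ} (a : Fin k → ℕ)

theorem contsAux_finiteCF (i : Fin k) :
    ((finiteCF a).contsAux (i + 2)).a =
        a i * ((finiteCF a).contsAux (i + 1)).a + ((finiteCF a).contsAux i).a ∧
      ((finiteCF a).contsAux (i + 2)).b =
        a i * ((finiteCF a).contsAux (i + 1)).b + ((finiteCF a).contsAux i).b :=
  contsAux_zeroHeadCF _ (by simp)

theorem contsAux_interlacedCF (u : ℕ → ℝ) (n : ℕ) :
    ((interlacedCF a u).contsAux (n + 2)).a =
        interlacedQuotients a u n * ((interlacedCF a u).contsAux (n + 1)).a +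
          ((interlacedCF a u).contsAux n).a ∧
      ((interlacedCF a u).contsAux (n + 2)).b =
        interlacedQuotients a u n * ((interlacedCF a u).contsAux (n + 1)).b +
          ((interlacedCF a u).contsAux n).b :=
  contsAux_zeroHeadCF _ (by simp [Stream'.Seq.ofStream]; rfl)

theorem interlacedQuotients_block (u : ℕ → ℝ) (j : ℕ) (i : Fin k) :
    interlacedQuotients a u ((k + 1) * j + i) = a i := by
  have h : ((k + 1) * j + i) % (k + 1) = i := by
    rw [Nat.mul_add_mod, Nat.mod_eq_of_lt (by omega)]
  simp [interlacedQuotients, h]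

theorem interlacedQuotients_last (u : ℕ → ℝ) (j : ℕ) :
    interlacedQuotients a u ((k + 1) * j + k) = u (j + 1) := by
  have h : ((k + 1) * j + k) % (k + 1) = k := by
    rw [Nat.mul_add_mod, Nat.mod_eq_of_lt (by omega)]
  have h' : ((k + 1) * j + k) / (k + 1) = j := by
    rw [Nat.mul_add_div (by omega), Nat.div_eq_of_lt (by omega), add_zero]
  simp [interlacedQuotients, h, h']

theorem one_le_interlacedQuotients (ha : ∀ i, 0 < a i) {u : ℕ → ℝ} (hu : ∀ n, 1 ≤ u (n + 1))
    (n : ℕ) : 1 ≤ interlacedQuotients a u n := by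
  unfold interlacedQuotients
  split_ifs with h
  · exact_mod_cast ha _
  · exact hu _

/-- The determinant formula for the canonical numerators and denominators. -/
theorem det_contsAux_finiteCF {n : ℕ} (hn : n ≤ k) :
    ((finiteCF a).contsAux (n + 1)).a * ((finiteCF a).contsAux n).b -
      ((finiteCF a).contsAux n).a * ((finiteCF a).contsAux (n + 1)).b = -(-1) ^ n := by
  induction n with
  | zero => simp [finiteCF, zeroHeadCF, GenContFract.contsAux]
  | succ n ih =>
    obtain ⟨h1, h2⟩ := contsAux_finiteCF a ⟨n, hn⟩
    have := ih (by omega)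
    simp only at h1 h2
    rw [h1, h2, pow_succ]
    linear_combination -this

theorem contsAux_finiteCF_nonneg (n : ℕ) (hn : n ≤ k + 1) :
    0 ≤ ((finiteCF a).contsAux n).a := by
  induction n using Nat.strong_induction_on with
  | _ n ih =>
    match n with
    | 0 => simp [GenContFract.contsAux]
    | 1 => simp [GenContFract.contsAux, finiteCF, zeroHeadCF]
    | n + 2 =>
      rw [(contsAux_finiteCF a ⟨n, by omega⟩).1]
      have h1 := ih (n + 1) (by omega) (by omega)
      have h2 := ih n (by omega) (by omega)
      positivity

theorem one_le_and_nonneg_of_recurrence {B b : ℕ → ℝ} {N : ℕ} (h0 : B 0 = 0) (h1 : B 1 = 1)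
    (hb : ∀ n < N, 1 ≤ b n) (h : ∀ n < N, B (n + 2) = b n * B (n + 1) + B n) :
    ∀ n ≤ N, 1 ≤ B (n + 1) ∧ 0 ≤ B n := by
  intro n
  induction n with
  | zero => intro _; rw [h0, h1]; norm_num
  | succ n ih =>
    intro hn
    obtain ⟨e1, e2⟩ := ih (by omega)
    refine ⟨?_, by linarith⟩
    rw [h n (by omega)]
    nlinarith [hb n (by omega)]

theorem one_le_contsAux_finiteCF (ha : ∀ i, 0 < a i) {n : ℕ} (hn : n ≤ k) :
    1 ≤ ((finiteCF a).contsAux (n + 1)).b := by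
  refine (one_le_and_nonneg_of_recurrence (B := fun n => ((finiteCF a).contsAux n).b)
    (b := fun n => if h : n < k then (a ⟨n, h⟩ : ℝ) else 1) (N := k)
    rfl rfl (fun n h => ?_) (fun n h => ?_) n hn).1
  · simp only [h, dite_true]
    exact_mod_cast ha _
  · simp only [h, dite_true]
    exact (contsAux_finiteCF a ⟨n, h⟩).2

theorem one_le_contsAux_interlacedCF (ha : ∀ i, 0 < a i) {u : ℕ → ℝ} (hu : ∀ n, 1 ≤ u (n + 1))
    (n : ℕ) : 1 ≤ ((interlacedCF a u).contsAux (n + 1)).b :=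
  (one_le_and_nonneg_of_recurrence (B := fun n => ((interlacedCF a u).contsAux n).b)
    rfl rfl (fun n _ => one_le_interlacedQuotients a ha hu n)
    (fun n _ => (contsAux_interlacedCF a u n).2) n le_rfl).1

/-- Across one block, a solution of the recurrence is a combination of the canonical numerators
and denominators. -/
theorem solution_in_block {u : ℕ → ℝ} {E : ℕ → ℂ}
    (hE : ∀ n, E (n + 2) = interlacedQuotients a u n * E (n + 1) + E n) (j : ℕ) {n : ℕ}
    (hn : n ≤ k + 1) : E ((k + 1) * j + n) =
      ((finiteCF a).contsAux n).b * E ((k + 1) * j + 1) +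
        ((finiteCF a).contsAux n).a * E ((k + 1) * j) := by
  induction n using Nat.strong_induction_on with
  | _ n ih =>
    match n with
    | 0 => simp [GenContFract.contsAux]
    | 1 => simp [GenContFract.contsAux, finiteCF, zeroHeadCF]
    | n + 2 =>
      have h1 := ih (n + 1) (by omega) (by omega)
      have h2 := ih n (by omega) (by omega)
      have h3 := hE ((k + 1) * j + n)
      obtain ⟨e1, e2⟩ := contsAux_finiteCF a ⟨n, by omega⟩
      have e3 := interlacedQuotients_block a u j ⟨n, by omega⟩
      simp only at e1 e2 e3
      rw [e3] at h3
      rw [← add_assoc, h3, add_assoc, h1, h2, e1, e2]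
      push_cast
      ring

/-- The solution of the recurrence at the ends of the blocks, in terms of a solution `w` of the
contracted recurrence. -/
theorem solution_at_block_ends {u : ℕ → ℝ} {E w : ℕ → ℂ}
    (hE : ∀ n, E (n + 2) = interlacedQuotients a u n * E (n + 1) + E n)
    (hw : ∀ j, w j = (((finiteCF a).contsAux k).b + ((finiteCF a).contsAux (k + 1)).a +
      u (j + 1) * ((finiteCF a).contsAux (k + 1)).b : ℝ) * w (j + 1) + (-1) ^ k * w (j + 2))
    (h0 : E 0 = -(((finiteCF a).contsAux (k + 1)).b * w 0))
    (h1 : E 1 = ((finiteCF a).contsAux (k + 1)).a * w 0 + (-1) ^ k * w 1) (j : ℕ) :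
    E ((k + 1) * j) = (-(-1) ^ k) ^ j * -(((finiteCF a).contsAux (k + 1)).b * w j) ∧
      E ((k + 1) * j + 1) = (-(-1) ^ k) ^ j *
        (((finiteCF a).contsAux (k + 1)).a * w j + (-1) ^ k * w (j + 1)) := by
  induction j with
  | zero => simp [h0, h1]
  | succ j ih =>
    obtain ⟨i0, i1⟩ := ih
    have e1 := solution_in_block a hE j (n := k + 1) le_rfl
    have e2 := solution_in_block a hE j (n := k) (by omega)
    have e3 := hE ((k + 1) * j + k)
    have hd := congrArg (fun x : ℝ => (x : ℂ)) (det_contsAux_finiteCF a le_rfl)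
    have hs : ((-1 : ℂ) ^ k) ^ 2 = 1 := by rw [← pow_mul, mul_comm, pow_mul]; simp
    have hwj := hw j
    rw [interlacedQuotients_last] at e3
    rw [show (k + 1) * (j + 1) = (k + 1) * j + (k + 1) by ring,
      show (k + 1) * j + (k + 1) + 1 = (k + 1) * j + k + 2 by ring]
    push_cast at hd hwj
    rw [e3, add_assoc _ k 1, e1, e2, i0, i1]
    generalize ((finiteCF a).contsAux (k + 1)).b = Q at *
    generalize ((finiteCF a).contsAux (k + 1)).a = P at *
    generalize ((finiteCF a).contsAux k).b = Q' at *
    generalize ((finiteCF a).contsAux k).a = P' at *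
    rw [pow_succ]
    generalize (-1 : ℂ) ^ k = ε at *
    generalize (-ε) ^ j = σ at *
    constructor
    · ring
    -- The determinant reduces the coefficient of `w j` to `-σ * ε`; the contracted recurrence then
    -- eliminates `w j`.
    · linear_combination σ * w j * hd - σ * ε * hwj

/-- A null solution of the contracted recurrence gives the limit of the interlaced continued
fraction. -/
theorem tendsto_convs_interlacedCF (ha : ∀ i, 0 < a i) {u : ℕ → ℝ} (hu : ∀ n, 1 ≤ u (n + 1))
    {w : ℕ → ℂ}
    (hw : ∀ j, w j = (((finiteCF a).contsAux k).b + ((finiteCF a).contsAux (k + 1)).a +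
      u (j + 1) * ((finiteCF a).contsAux (k + 1)).b : ℝ) * w (j + 1) + (-1) ^ k * w (j + 2))
    (hlim : Tendsto w atTop (𝓝 0)) (hne : ∃ j, w j ≠ 0) :
    w 0 ≠ 0 ∧ Tendsto (fun n => (((interlacedCF a u).convs n : ℝ) : ℂ)) atTop
      (𝓝 ((((finiteCF a).contsAux (k + 1)).a * w 0 + (-1) ^ k * w 1) /
        (((finiteCF a).contsAux (k + 1)).b * w 0))) := by
  set P := ((finiteCF a).contsAux (k + 1)).a with hP
  set Q := ((finiteCF a).contsAux (k + 1)).b with hQ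
  set t0 : ℂ := P * w 0 + (-1) ^ k * w 1 with ht0
  set t1 : ℂ := Q * w 0 with ht1
  set A : ℕ → ℝ := fun n => ((interlacedCF a u).contsAux n).a with hA
  set B : ℕ → ℝ := fun n => ((interlacedCF a u).contsAux n).b with hB
  -- The solution with `E 0 = -t1` and `E 1 = t0`, the initial values that match `w` at the block
  -- ends.
  set E : ℕ → ℂ := fun n => B n * t0 - A n * t1 with hEdef
  have hQ1 : 1 ≤ Q := one_le_contsAux_finiteCF a ha le_rfl
  have hQ0 : (Q : ℂ) ≠ 0 := by exact_mod_cast (by linarith : Q ≠ 0)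
  have hE : ∀ n, E (n + 2) = interlacedQuotients a u n * E (n + 1) + E n := fun n => by
    obtain ⟨e1, e2⟩ := contsAux_interlacedCF a u n
    simp only [hEdef, hA, hB, e1, e2]
    push_cast
    ring
  have hends := solution_at_block_ends a hE hw
    (by simp [hEdef, hA, hB, GenContFract.contsAux, ht1, hQ])
    (by simp [hEdef, hA, hB, GenContFract.contsAux, ht0, hP, interlacedCF, zeroHeadCF])
  have hσ : ∀ j, ‖(-(-1 : ℂ) ^ k) ^ j‖ = 1 := fun j => by simp
  have hB1 : ∀ n, 1 ≤ B (n + 1) := one_le_contsAux_interlacedCF a ha hu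
  have hE0 : Tendsto (fun j => E ((k + 1) * j)) atTop (𝓝 0) := by
    rw [tendsto_zero_iff_norm_tendsto_zero]
    simp_rw [fun j => (hends j).1, norm_mul, hσ]
    simpa using (hlim.norm.const_mul ‖(Q : ℂ)‖)
  have hE1 : Tendsto (fun j => E ((k + 1) * j + 1)) atTop (𝓝 0) := by
    rw [tendsto_zero_iff_norm_tendsto_zero]
    simp_rw [fun j => (hends j).2, norm_mul, hσ]
    simpa using ((hlim.const_mul (P : ℂ)).add
      ((hlim.comp (tendsto_add_atTop_nat 1)).const_mul ((-1 : ℂ) ^ k))).norm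
  have hEr : ∀ r ≤ k, Tendsto (fun j => E ((k + 1) * j + r)) atTop (𝓝 0) := fun r hr => by
    simp_rw [fun j => solution_in_block a hE j (n := r) (by omega)]
    simpa using (hE1.const_mul _).add (hE0.const_mul _)
  have hElim : Tendsto E atTop (𝓝 0) := by
    rw [Metric.tendsto_atTop]
    intro ε hε
    have : ∀ᶠ j in atTop, ∀ r ∈ Finset.range (k + 1), dist (E ((k + 1) * j + r)) 0 < ε :=
      (Finset.eventually_all _).2 fun r hr => (Metric.tendsto_nhds.1
        (hEr r (by simpa [Nat.lt_succ_iff] using hr))) ε hε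
    obtain ⟨J, hJ⟩ := eventually_atTop.1 this
    refine ⟨(k + 1) * J, fun n hn => ?_⟩
    have h := hJ (n / (k + 1)) ((Nat.le_div_iff_mul_le (by omega)).2 (by rwa [mul_comm]))
      (n % (k + 1)) (Finset.mem_range.2 (Nat.mod_lt _ (by omega)))
    rwa [Nat.div_add_mod] at h
  have hconv : ∀ n, (((interlacedCF a u).convs n : ℝ) : ℂ) * B (n + 1) = A (n + 1) := fun n => by
    have h : B (n + 1) ≠ 0 := by linarith [hB1 n]
    have h' : (interlacedCF a u).convs n = A (n + 1) / B (n + 1) := rfl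
    rw [h', ← Complex.ofReal_mul, div_mul_cancel₀ _ h]
  have hdiff : Tendsto (fun n => t0 - (((interlacedCF a u).convs n : ℝ) : ℂ) * t1) atTop (𝓝 0) := by
    refine squeeze_zero_norm (fun n => ?_)
      (tendsto_zero_iff_norm_tendsto_zero.1 (hElim.comp (tendsto_add_atTop_nat 1)))
    have e : E (n + 1) = B (n + 1) * (t0 - (((interlacedCF a u).convs n : ℝ) : ℂ) * t1) := by
      simp only [hEdef]
      rw [← hconv n]
      ring
    rw [Function.comp_apply, e, norm_mul]
    refine le_mul_of_one_le_left (norm_nonneg _) ?_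
    rw [Complex.norm_real, Real.norm_eq_abs]
    exact (hB1 n).trans (le_abs_self _)
  -- If `w 0 = 0` then `t1 = 0`, so `t0 = 0` by the limit; then `E` vanishes identically, and with
  -- it `w`.
  have hw0 : w 0 ≠ 0 := by
    intro h
    have ht1' : t1 = 0 := by rw [ht1, h, mul_zero]
    have ht0' : t0 = 0 := by
      simp only [ht1', mul_zero, sub_zero] at hdiff
      exact tendsto_nhds_unique tendsto_const_nhds hdiff
    obtain ⟨j, hj⟩ := hne
    have e := (hends j).1
    have hs : (-(-1 : ℂ) ^ k) ^ j ≠ 0 := norm_ne_zero_iff.1 (by rw [hσ]; norm_num)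
    have : E ((k + 1) * j) = 0 := by simp [hEdef, ht0', ht1']
    rw [this] at e
    have := mul_ne_zero hs (neg_ne_zero.2 (mul_ne_zero hQ0 hj))
    exact this e.symm
  have ht1ne : t1 ≠ 0 := mul_ne_zero hQ0 hw0
  refine ⟨hw0, ?_⟩
  have := (hdiff.const_sub t0).div_const t1
  simpa [ht1ne] using this

end

/-! ### The null solution of the contracted recurrence. -/

theorem lowerTerm_eq_shiftTerm (m D α β : ℂ) :
    lowerTerm m D α β = shiftTerm (1 / m) (α / D) (β / D) 0 := by
  funext n
  unfold lowerTerm shiftTerm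
  rw [show -α / (D * m) = -(α / D * (1 / m) ^ (0 + 1)) by ring]
  simp

theorem upperTerm_eq_shiftTerm (m D α β : ℂ) :
    upperTerm m D α β = shiftTerm (1 / m) (α / D) (β / D) 1 := by
  funext n
  unfold upperTerm shiftTerm
  have h : n * (n + 3) / 2 = n * (n + 1) / 2 + n := by
    rw [show n * (n + 3) = n * (n + 1) + n * 2 by ring, Nat.add_mul_div_right _ _ (by norm_num)]
  rw [show -α / (D * m ^ 2) = -(α / D * (1 / m) ^ (1 + 1)) by ring, h]
  congr 1
  rw [pow_add, one_div, mul_pow, inv_pow, inv_pow]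
  ring

/-- The normalised `q`-series, a solution of the contracted recurrence. -/
def contractedSolution (m D α β : ℂ) (j : ℕ) : ℂ :=
  shiftSum (1 / m) (α / D) (β / D) j / ∏ i ∈ Finset.range j, (m ^ (i + 1) * D + α)

section

variable {m D α β : ℂ}

theorem one_add_ne_zero_of_pow_mul_add_ne_zero (hm : m ≠ 0) (hD : D ≠ 0)
    (h : ∀ i, m ^ (i + 1) * D + α ≠ 0) (i : ℕ) : 1 + α / D * (1 / m) ^ (i + 1) ≠ 0 := by
  have e : 1 + α / D * (1 / m) ^ (i + 1) = (m ^ (i + 1) * D + α) / (m ^ (i + 1) * D) := by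
    rw [one_div, inv_pow]; field_simp
  rw [e]
  exact div_ne_zero (h i) (mul_ne_zero (pow_ne_zero _ hm) hD)

/-- Multiplying the series recurrence by `m^(j+1) D` turns `1 + (α/D) q^(j+1)` into the next factor
of the normalising product. -/
theorem contractedSolution_recurrence (hm : 1 < ‖m‖) (hD : D ≠ 0) (hβ : β ≠ 0)
    (h : ∀ i, m ^ (i + 1) * D + α ≠ 0) (j : ℕ) :
    contractedSolution m D α β j = (α + β + D * m ^ (j + 1)) * contractedSolution m D α β (j + 1)
      - α * β * contractedSolution m D α β (j + 2) := by
  have hm0 : m ≠ 0 := norm_pos_iff.1 (by linarith)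
  have hq : ‖1 / m‖ < 1 := by
    rw [norm_div, norm_one]; exact (div_lt_one (by linarith)).2 hm
  have r := shiftSum_recurrence (one_div_ne_zero hm0) hq (div_ne_zero hβ hD)
    (one_add_ne_zero_of_pow_mul_add_ne_zero hm0 hD h) j
  have h1 := h j
  have h2 := h (j + 1)
  have e1 : 1 + α / D * (1 / m) ^ (j + 1) = (m ^ (j + 1) * D + α) / (m ^ (j + 1) * D) := by
    rw [one_div, inv_pow]; field_simp
  have e2 : 1 + α / D * (1 / m) ^ (j + 2) =
      (m ^ (j + 1 + 1) * D + α) / (m ^ (j + 1 + 1) * D) := by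
    rw [one_div, inv_pow]; field_simp
  have hp : ∏ i ∈ Finset.range j, (m ^ (i + 1) * D + α) ≠ 0 :=
    Finset.prod_ne_zero_iff.2 fun i _ => h i
  unfold contractedSolution
  rw [Finset.prod_range_succ _ (j + 1), Finset.prod_range_succ]
  rw [e1, e2] at r
  have r' : (m ^ (j + 1) * D + α) * shiftSum (1 / m) (α / D) (β / D) j =
      (α + β + D * m ^ (j + 1)) * shiftSum (1 / m) (α / D) (β / D) (j + 1) -
        α * β / (m ^ (j + 1 + 1) * D + α) * shiftSum (1 / m) (α / D) (β / D) (j + 2) := by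
    have hmj : m ^ (j + 1) * D ≠ 0 := mul_ne_zero (pow_ne_zero _ hm0) hD
    have r2 := congrArg (fun x => m ^ (j + 1) * D * x) r
    have c0 : m ^ (j + 1) * D * ((m ^ (j + 1) * D + α) / (m ^ (j + 1) * D) *
        shiftSum (1 / m) (α / D) (β / D) j) =
        (m ^ (j + 1) * D + α) * shiftSum (1 / m) (α / D) (β / D) j := by
      rw [← mul_assoc, mul_div_cancel₀ _ hmj]
    have c1 : m ^ (j + 1) * D * (1 + (α / D + β / D) * (1 / m) ^ (j + 1)) =
        α + β + D * m ^ (j + 1) := by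
      rw [one_div, inv_pow]; field_simp; ring
    have c2 : m ^ (j + 1) * D * (α / D * (β / D) * (1 / m) ^ (2 * j + 3) /
        ((m ^ (j + 1 + 1) * D + α) / (m ^ (j + 1 + 1) * D))) =
        α * β / (m ^ (j + 1 + 1) * D + α) := by
      rw [div_div_eq_mul_div, ← mul_div_assoc]
      congr 1
      rw [one_div, inv_pow]
      field_simp
      ring
    rw [c0] at r2
    rw [r2, ← c1, ← c2]
    ring
  generalize m ^ (j + 1 + 1) * D + α = V at *
  generalize m ^ (j + 1) * D + α = U at *
  generalize ∏ i ∈ Finset.range j, (m ^ (i + 1) * D + α) = p at *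
  have : shiftSum (1 / m) (α / D) (β / D) j = ((α + β + D * m ^ (j + 1)) *
      shiftSum (1 / m) (α / D) (β / D) (j + 1) -
        α * β / V * shiftSum (1 / m) (α / D) (β / D) (j + 2)) / U := by
    rw [← r', mul_div_cancel_left₀ _ h1]
  rw [this]
  ring

theorem tendsto_contractedSolution (hm : 1 < ‖m‖) (hD : D ≠ 0) (hβ : β ≠ 0)
    (h : ∀ i, m ^ (i + 1) * D + α ≠ 0) :
    Tendsto (contractedSolution m D α β) atTop (𝓝 0) ∧ ∃ j, contractedSolution m D α β j ≠ 0 := by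
  have hm0 : m ≠ 0 := norm_pos_iff.1 (by linarith)
  have hq : ‖1 / m‖ < 1 := by
    rw [norm_div, norm_one]; exact (div_lt_one (by linarith)).2 hm
  have hS := tendsto_shiftSum (one_div_ne_zero hm0) hq (div_ne_zero hβ hD)
    (one_add_ne_zero_of_pow_mul_add_ne_zero hm0 hD h)
  have hp : ∀ j, ∏ i ∈ Finset.range j, (m ^ (i + 1) * D + α) ≠ 0 := fun j =>
    Finset.prod_ne_zero_iff.2 fun i _ => h i
  constructor
  · have hgrow : Tendsto (fun j : ℕ => ‖m ^ (j + 1) * D + α‖) atTop atTop := by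
      have h1 : Tendsto (fun j : ℕ => ‖m‖ ^ (j + 1) * ‖D‖ - ‖α‖) atTop atTop :=
        tendsto_atTop_add_const_right _ _ (((tendsto_pow_atTop_atTop_of_one_lt hm).comp
          (tendsto_add_atTop_nat 1)).atTop_mul_const (norm_pos_iff.2 hD))
      refine tendsto_atTop_mono (fun j => ?_) h1
      rw [← norm_pow, ← norm_mul]
      simpa using norm_sub_norm_le (m ^ (j + 1) * D) (-α)
    -- Past `N` every factor has norm at least 2, so the inverse products decay geometrically.
    obtain ⟨N, hN⟩ := eventually_atTop.1 (hgrow.eventually_ge_atTop 2)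
    have hinv : Tendsto (fun j => (∏ i ∈ Finset.range j, (m ^ (i + 1) * D + α))⁻¹) atTop (𝓝 0) := by
      rw [← tendsto_add_atTop_iff_nat N]
      set p := ∏ i ∈ Finset.range N, (m ^ (i + 1) * D + α) with hpdef
      refine squeeze_zero_norm (a := fun j : ℕ => ‖p‖⁻¹ * (1 / 2 : ℝ) ^ j) (fun j => ?_) ?_
      · induction j with
        | zero => simp [hpdef]
        | succ j ih =>
          rw [show j + 1 + N = j + N + 1 by ring, Finset.prod_range_succ, mul_inv, norm_mul,
            pow_succ (1 / 2 : ℝ), ← mul_assoc]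
          refine mul_le_mul ih ?_ (norm_nonneg _) (by positivity)
          rw [norm_inv, one_div]
          exact inv_anti₀ two_pos (hN (j + N) (by omega))
      · simpa using (tendsto_pow_atTop_nhds_zero_of_lt_one (r := (1 / 2 : ℝ)) (by norm_num)
          (by norm_num)).const_mul ‖p‖⁻¹
    have := hS.mul hinv
    rw [mul_zero] at this
    exact this
  · obtain ⟨j, hj⟩ := (hS.eventually_ne one_ne_zero).exists
    exact ⟨j, div_ne_zero hj (hp j)⟩

end

/-! ### Nondegeneracy and the closed form. -/

/-- A zero would force `α` to be real with `α ≤ -1`, hence `β` real with `β ≥ 2`, so `αβ ≤ -2`; but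
`αβ = -ε ≥ -1`. -/
theorem pow_mul_add_ne_zero {P Q Q' c d m : ℝ} {ε : ℝ} {α β : ℂ} (hm : 1 ≤ m) (hP : 0 ≤ P)
    (hQ : 1 ≤ Q) (hQ' : 1 ≤ Q') (hd : 0 < d) (hdm : 1 ≤ d * m) (hc : 1 ≤ c + d * m) (hε : ε ≤ 1)
    (hsum : α + β = (Q' + P + c * Q : ℝ)) (hprod : α * β = -(ε : ℂ)) (i : ℕ) :
    (m : ℂ) ^ (i + 1) * ((d : ℂ) * (Q : ℂ)) + α ≠ 0 := by
  intro h
  have hα : α = -((m ^ (i + 1) * (d * Q) : ℝ) : ℂ) := by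
    push_cast
    linear_combination h
  have hβ : β = ((Q' + P + c * Q + m ^ (i + 1) * (d * Q) : ℝ) : ℂ) := by
    rw [Complex.ofReal_add, ← hsum, hα]
    ring
  rw [hα, hβ, ← Complex.ofReal_neg, ← Complex.ofReal_mul, ← Complex.ofReal_neg,
    Complex.ofReal_inj] at hprod
  have hpow : d * m ≤ d * m ^ (i + 1) :=
    mul_le_mul_of_nonneg_left (le_self_pow₀ hm (by omega)) hd.le
  have h1 : 1 ≤ m ^ (i + 1) * (d * Q) := by nlinarith
  have h2 : 2 ≤ Q' + P + c * Q + m ^ (i + 1) * (d * Q) := by nlinarith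
  nlinarith

/-- Only the sum and product of `α` and `β` matter, which treats both parities, and real or non-real
roots, at once. -/
theorem interlacedCF_closed_form {k : ℕ} (hk : 1 ≤ k) (a : Fin k → ℕ) (ha : ∀ i, 0 < a i)
    {c d m : ℝ} (hm : 1 < m) (hd : 0 < d) (hdm : 1 ≤ d * m) (hcd : 1 ≤ c + d * m) {α β : ℂ}
    (hsum : α + β = (convDen a (k - 1) + convNum a k + c * convDen a k : ℝ))
    (hprod : α * β = -(-1) ^ k) :
    ClosedFormWellDefined m ((d : ℂ) * (convDen a k : ℂ)) α β ∧
      Tendsto (fun n => (((interlacedCF a fun n => c + d * m ^ n).convs n : ℝ) : ℂ)) atTop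
        (𝓝 ((convNum a k : ℂ) / (convDen a k : ℂ) +
          (-1) ^ k / ((convDen a k : ℂ) * (m * ((d : ℂ) * (convDen a k : ℂ)) + α)) *
          ((∑' n, upperTerm m ((d : ℂ) * (convDen a k : ℂ)) α β n) /
            (∑' n, lowerTerm m ((d : ℂ) * (convDen a k : ℂ)) α β n)))) := by
  have eP : convNum a k = ((finiteCF a).contsAux (k + 1)).a := rfl
  have eQ : convDen a k = ((finiteCF a).contsAux (k + 1)).b := rfl
  -- Here `k ≥ 1` matters, because `k - 1` is truncated.
  have eQ' : convDen a (k - 1) = ((finiteCF a).contsAux k).b := by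
    obtain ⟨l, rfl⟩ := Nat.exists_eq_add_of_le' hk
    rfl
  have hQ : 1 ≤ convDen a k := one_le_contsAux_finiteCF a ha le_rfl
  have hQ' : 1 ≤ convDen a (k - 1) := one_le_contsAux_finiteCF a ha (by omega)
  have hP : 0 ≤ convNum a k := contsAux_finiteCF_nonneg a _ le_rfl
  have hne := pow_mul_add_ne_zero (ε := (-1) ^ k) hm.le hP hQ hQ' hd hdm hcd
    ((le_abs_self _).trans (by simp)) hsum (by push_cast; exact hprod)
  have hu : ∀ n, 1 ≤ c + d * m ^ (n + 1) := fun n =>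
    hcd.trans (by gcongr; exact le_self_pow₀ hm.le (by omega))
  have hQ0 : (convDen a k : ℂ) ≠ 0 := by
    exact_mod_cast (by linarith : convDen a k ≠ 0)
  have hd0 : (d : ℂ) ≠ 0 := by exact_mod_cast hd.ne'
  have hD := mul_ne_zero hd0 hQ0
  have hβ : β ≠ 0 := by
    rintro rfl
    rw [mul_zero] at hprod
    exact neg_ne_zero.2 (pow_ne_zero k (neg_ne_zero.2 one_ne_zero)) hprod.symm
  have hm' : 1 < ‖(m : ℂ)‖ := by
    rw [Complex.norm_real]
    exact hm.trans_le (le_abs_self _)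
  have hm0 : (m : ℂ) ≠ 0 := norm_pos_iff.1 (by linarith)
  have hq : ‖1 / (m : ℂ)‖ < 1 := by
    rw [norm_div, norm_one]; exact (div_lt_one (by linarith)).2 hm'
  have hone := one_add_ne_zero_of_pow_mul_add_ne_zero hm0 hD hne
  obtain ⟨hlim, hex⟩ := tendsto_contractedSolution hm' hD hβ hne
  obtain ⟨hw0, hconv⟩ := tendsto_convs_interlacedCF a ha (u := fun n => c + d * m ^ n) hu (fun j => by
    rw [contractedSolution_recurrence hm' hD hβ hne j, hprod, hsum, ← eP, ← eQ, ← eQ']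
    push_cast
    ring) hlim hex
  have e0 : contractedSolution m ((d : ℂ) * (convDen a k : ℂ)) α β 0 =
      ∑' n, lowerTerm m ((d : ℂ) * (convDen a k : ℂ)) α β n := by
    simp [contractedSolution, lowerTerm_eq_shiftTerm, shiftSum]
  have e1 : contractedSolution m ((d : ℂ) * (convDen a k : ℂ)) α β 1 =
      (∑' n, upperTerm m ((d : ℂ) * (convDen a k : ℂ)) α β n) /
        (m * ((d : ℂ) * (convDen a k : ℂ)) + α) := by
    simp [contractedSolution, upperTerm_eq_shiftTerm, shiftSum]
  have hmD : (m : ℂ) * ((d : ℂ) * (convDen a k : ℂ)) + α ≠ 0 := by simpa using hne 0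
  have hsummable := summable_shiftTerm (one_div_ne_zero hm0) hq (div_ne_zero hβ hD) hone
  rw [e0] at hw0
  refine ⟨⟨hmD, qProd_self_ne_zero hq, fun n => ?_, fun n => ?_, ?_, ?_, hw0⟩, ?_⟩
  · convert qProd_shift_ne_zero hone 1 n using 2
    ring
  · convert qProd_shift_ne_zero hone 0 n using 2
    ring
  · rw [upperTerm_eq_shiftTerm]
    exact hsummable 1
  · rw [lowerTerm_eq_shiftTerm]
    exact hsummable 0
  · rw [e0, e1, ← eP, ← eQ] at hconv
    convert hconv using 2
    generalize (∑' n, lowerTerm (m : ℂ) ((d : ℂ) * (convDen a k : ℂ)) α β n) = L at *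
    generalize (m : ℂ) * ((d : ℂ) * (convDen a k : ℂ)) + α = U at *
    field_simp

end

theorem mainTheorem12 (k : ℕ) (hk : 1 ≤ k) (a : Fin k → ℕ) (ha : ∀ i, 0 < a i)
    (c m : ℤ) (hm : 1 < m) (d : ℚ) (hd : 0 < d)
    (hdm : ∃ N : ℕ, d * (m : ℚ) = (N : ℚ)) (hcd : 0 < (c : ℚ) + d * (m : ℚ)) :
    let P : ℝ := convNum a k
    let Q : ℝ := convDen a k
    let C : ℝ := convDen a (k - 1) + P + (c : ℝ) * Q
    let D : ℂ := (d : ℂ) * (Q : ℂ)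
    let x : ℕ → ℝ := (interlacedCF a fun n => (c : ℝ) + (d : ℝ) * (m : ℝ) ^ n).convs
    (Even k →
      let α : ℂ := ((C : ℂ) - Complex.sqrt ((C : ℂ) ^ 2 + 4)) / 2
      let β : ℂ := ((C : ℂ) + Complex.sqrt ((C : ℂ) ^ 2 + 4)) / 2
      ClosedFormWellDefined (m : ℂ) D α β ∧
      Tendsto (fun n => ((x n : ℝ) : ℂ)) atTop
        (𝓝 ((P : ℂ) / (Q : ℂ) + 1 / ((Q : ℂ) * ((m : ℂ) * D + α)) *
          ((∑' n, upperTerm (m : ℂ) D α β n) / (∑' n, lowerTerm (m : ℂ) D α β n))))) ∧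
    (Odd k →
      let α : ℂ := ((C : ℂ) - Complex.sqrt ((C : ℂ) ^ 2 - 4)) / 2
      let β : ℂ := ((C : ℂ) + Complex.sqrt ((C : ℂ) ^ 2 - 4)) / 2
      ClosedFormWellDefined (m : ℂ) D α β ∧
      Tendsto (fun n => ((x n : ℝ) : ℂ)) atTop
        (𝓝 ((P : ℂ) / (Q : ℂ) + (-1) / ((Q : ℂ) * ((m : ℂ) * D + α)) *
          ((∑' n, upperTerm (m : ℂ) D α β n) / (∑' n, lowerTerm (m : ℂ) D α β n))))) := by
  have hm' : (1 : ℝ) < m := by exact_mod_cast hm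
  have hd' : (0 : ℝ) < d := by exact_mod_cast hd
  obtain ⟨N, hN⟩ := hdm
  have hm0 : (0 : ℚ) < m := by exact_mod_cast (by omega : 0 < m)
  -- Integrality of `d * m` and of `c + d * m` upgrades positivity to a lower bound of 1.
  have hdm1 : (1 : ℝ) ≤ d * m := by
    have h1 : (0 : ℚ) < N := hN ▸ mul_pos hd hm0
    have h2 : (1 : ℚ) ≤ d * m := by
      rw [hN]
      exact_mod_cast (by exact_mod_cast h1 : 0 < N)
    exact_mod_cast h2
  have hcd1 : (1 : ℝ) ≤ c + d * m := by
    have h2 : (1 : ℚ) ≤ c + d * m := by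
      rw [hN] at hcd ⊢
      have h1 : (0 : ℤ) < c + N := by exact_mod_cast hcd
      exact_mod_cast (by omega : (1 : ℤ) ≤ c + N)
    exact_mod_cast h2
  have hsq : ∀ z : ℂ, Complex.sqrt z ^ 2 = z := fun z => by
    simp [Complex.sqrt]
  intro P Q C D x
  constructor
  · intro heven α β
    have key := interlacedCF_closed_form hk a ha hm' hd' hdm1 hcd1 (α := α) (β := β)
      (by simp only [α, β]; ring) (by
        rw [heven.neg_one_pow]
        simp only [α, β]
        linear_combination -(1 / 4) * hsq ((C : ℂ) ^ 2 + 4))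
    rw [heven.neg_one_pow] at key
    simpa only [Complex.ofReal_intCast, Complex.ofReal_ratCast] using key
  · intro hodd α β
    have key := interlacedCF_closed_form hk a ha hm' hd' hdm1 hcd1 (α := α) (β := β)
      (by simp only [α, β]; ring) (by
        rw [hodd.neg_one_pow]
        simp only [α, β]
        linear_combination -(1 / 4) * hsq ((C : ℂ) ^ 2 - 4))
    rw [hodd.neg_one_pow] at key
    simpa only [Complex.ofReal_intCast, Complex.ofReal_ratCast] using key
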